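/- Let $N\ge 2$ be an integer, let $\mathbb{R}^N_+=\mathbb{R}^{N-1}\times(0,\infty)$, and identify $\partial\mathbb{R}^N_+=\mathbb{R}^{N-1}\times\{0\}$ with $\mathbb{R}^{N-1}$, equipped with Lebesgue measure. For a locally integrable function $v\colon\partial\mathbb{R}^N_+\to\mathbb{R}$, its total variation is $$\int_{\partial\mathbb{R}^N_+}|\mathrm{D}v| = \sup\Bigl\{\int_{\mathbb{R}^{N-1}} v\,\operatorname{div}\varphi \;:\; \varphi\in C^1_c(\mathbb{R}^{N-1};\mathbb{R}^{N-1}),\ |\varphi|\le 1\Bigr\}\in[0,\infty],$$ and $v\in BV(\partial\mathbb{R}^N_+)$ means that $v$ is locally integrable and $\int_{\partial\mathbb{R}^N_+}|\mathrm{D}v|<\infty$ (integrability of $v$ itself over $\partial\mathbb{R}^N_+$ is not required). There exists a constant $C\in[0,\infty)$, depending only on $N$, such that the following holds. If the functions $u\colon\mathbb{R}^N_+\to\mathbb{R}$ and $v\colon\partial\mathbb{R}^N_+\to\mathbb{R}$ are (Lebesgue) measurable and satisfy $$\liminf_{s\to1^-}\,(1-s)\int_{\partial\mathbb{R}^N_+}\Bigl(\int_{\mathbb{R}^N_+}\frac{|v(x)-u(y)|}{|x-y|^{N+s}}\,\mathrm{d}y\Bigr)\mathrm{d}x<\infty,$$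 then $v\in BV(\partial\mathbb{R}^N_+)$ and $$\int_{\partial\mathbb{R}^N_+}|\mathrm{D}v|\le C\,\liminf_{s\to1^-}\,(1-s)\int_{\partial\mathbb{R}^N_+}\Bigl(\int_{\mathbb{R}^N_+}\frac{|v(x)-u(y)|}{|x-y|^{N+s}}\,\mathrm{d}y\Bigr)\mathrm{d}x.$$ -/

import Mathlib

open MeasureTheory Filter Topology
open scoped NNReal ENNReal

namespace TraceConjunction

/-- The open upper half-space `ℝ^N_+ = ℝ^(N-1) × (0, ∞)` of `ℝ^N`, where `N = n + 1`. -/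
def halfSpace (n : ℕ) : Set (EuclideanSpace ℝ (Fin (n + 1))) :=
  {y | 0 < y (Fin.last n)}

/-- The identification of `ℝ^n = ℝ^(N-1)` with the boundary `∂ℝ^N_+ = ℝ^(N-1) × {0}` of the
half-space, where `N = n + 1`. Functions on `∂ℝ^N_+` and integrals over it are functions on
`ℝ^n` and integrals for the Lebesgue measure of `ℝ^n`. -/
def boundaryPoint {n : ℕ} (x : EuclideanSpace ℝ (Fin n)) : EuclideanSpace ℝ (Fin (n + 1)) :=
  WithLp.toLp 2 (Fin.snoc (α := fun _ => ℝ) (fun i => x i) 0)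

/-- The trace conjunction integral with `p = 1` and `N = n + 1`,
`∫_{∂ℝ^N_+} (∫_{ℝ^N_+} |v x - u y| / |x - y|^(N + s) dy) dx`, with values in `[0, ∞]`.
Only the values of `u` on the half-space matter. -/
noncomputable def conjunctionIntegral {n : ℕ} (s : ℝ) (u : EuclideanSpace ℝ (Fin (n + 1)) → ℝ)
    (v : EuclideanSpace ℝ (Fin n) → ℝ) : ℝ≥0∞ :=
  ∫⁻ x : EuclideanSpace ℝ (Fin n), ∫⁻ y in halfSpace n,
    ENNReal.ofReal (|v x - u y| / ‖boundaryPoint x - y‖ ^ (((n + 1 : ℕ) : ℝ) + s))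

/-- The divergence of a vector field on `ℝ^n`. -/
noncomputable def divergence {n : ℕ}
    (φ : EuclideanSpace ℝ (Fin n) → EuclideanSpace ℝ (Fin n)) (x : EuclideanSpace ℝ (Fin n)) : ℝ :=
  ∑ i : Fin n, fderiv ℝ φ x (EuclideanSpace.single i 1) i

/-- The total variation `∫ |D v|` on `ℝ^n`: the supremum of `∫ v div φ` over all continuously
differentiable, compactly supported vector fields `φ` with `|φ| ≤ 1` everywhere. It is meant for
locally integrable `v`, for which all these integrals converge. -/
noncomputable def totalVariation {n : ℕ} (v : EuclideanSpace ℝ (Fin n) → ℝ) : ℝ≥0∞ :=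
  ⨆ (φ : EuclideanSpace ℝ (Fin n) → EuclideanSpace ℝ (Fin n)) (_ : ContDiff ℝ 1 φ)
    (_ : HasCompactSupport φ) (_ : ∀ x, ‖φ x‖ ≤ 1),
    ENNReal.ofReal (∫ x, v x * divergence φ x)

/-- Functions of bounded variation on `ℝ^n` (homogeneous space): locally integrable functions
of finite total variation, equivalently those whose distributional derivative is a finite
vector-valued Radon measure. -/
def IsBV {n : ℕ} (v : EuclideanSpace ℝ (Fin n) → ℝ) : Prop :=
  LocallyIntegrable v volume ∧ totalVariation v < ∞

end TraceConjunction

namespace TraceConjunction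

section Oscillation

variable {n : ℕ} {v w : EuclideanSpace ℝ (Fin n) → ℝ} {t : ℝ}

/-- The integral of `|v x - w y|` over the pairs of points at distance less than `t`. -/
noncomputable def ballOscillation (t : ℝ) (v w : EuclideanSpace ℝ (Fin n) → ℝ) : ℝ≥0∞ :=
  ∫⁻ x, ∫⁻ y in Metric.ball x t, ENNReal.ofReal |v x - w y|

theorem lintegral_ball_eq_indicator (x : EuclideanSpace ℝ (Fin n)) (t : ℝ)
    (f : EuclideanSpace ℝ (Fin n) → ℝ≥0∞) :
    ∫⁻ y in Metric.ball x t, f y =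
      ∫⁻ y, {p : EuclideanSpace ℝ (Fin n) × EuclideanSpace ℝ (Fin n) | dist p.2 p.1 < t}.indicator
        (fun p => f p.2) (x, y) := by
  rw [← lintegral_indicator Metric.isOpen_ball.measurableSet]
  rfl

theorem measurableSet_dist_lt (t : ℝ) : MeasurableSet
    {p : EuclideanSpace ℝ (Fin n) × EuclideanSpace ℝ (Fin n) | dist p.2 p.1 < t} :=
  measurableSet_lt (by fun_prop) (by fun_prop)

theorem measurable_ofReal_abs_sub (hv : Measurable v) (hw : Measurable w) :
    Measurable fun p : EuclideanSpace ℝ (Fin n) × EuclideanSpace ℝ (Fin n) =>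
      ENNReal.ofReal |v p.1 - w p.2| :=
  ENNReal.measurable_ofReal.comp (continuous_abs.measurable.comp
    ((hv.comp measurable_fst).sub (hw.comp measurable_snd)))

theorem measurable_lintegral_ball (hv : Measurable v) (hw : Measurable w) (t : ℝ) :
    Measurable fun x => ∫⁻ y in Metric.ball x t, ENNReal.ofReal |v x - w y| := by
  simp_rw [lintegral_ball_eq_indicator]
  exact ((measurable_ofReal_abs_sub hv hw).indicator
    (measurableSet_dist_lt t)).lintegral_prod_right' (ν := volume)

theorem ballOscillation_swap (hv : Measurable v) (hw : Measurable w) (t : ℝ) :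
    ballOscillation t v w = ballOscillation t w v := by
  unfold ballOscillation
  calc _ = ∫⁻ x, ∫⁻ y, {p : EuclideanSpace ℝ (Fin n) × EuclideanSpace ℝ (Fin n) |
        dist p.2 p.1 < t}.indicator (fun p => ENNReal.ofReal |v p.1 - w p.2|) (x, y) := by
        refine lintegral_congr fun x => ?_
        rw [lintegral_ball_eq_indicator]
        rfl
    _ = ∫⁻ y, ∫⁻ x, {p : EuclideanSpace ℝ (Fin n) × EuclideanSpace ℝ (Fin n) |
        dist p.2 p.1 < t}.indicator (fun p => ENNReal.ofReal |v p.1 - w p.2|) (x, y) :=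
        lintegral_lintegral_swap ((measurable_ofReal_abs_sub hv hw).indicator
          (measurableSet_dist_lt t)).aemeasurable
    _ = _ := by
        refine lintegral_congr fun y => ?_
        rw [lintegral_ball_eq_indicator]
        refine lintegral_congr fun x => ?_
        simp only [Set.indicator, Set.mem_ofPred_eq, dist_comm, abs_sub_comm]

theorem locallyIntegrable_of_ballOscillation_lt_top (hv : Measurable v) (hw : Measurable w)
    (ht : 0 < t) (h : ballOscillation t v w < ∞) : LocallyIntegrable v volume := by
  rw [ballOscillation_swap hv hw] at h
  have hae := ae_lt_top (measurable_lintegral_ball hw hv t) h.ne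
  intro z
  obtain ⟨y, hy, hzy⟩ := (Measure.dense_of_ae hae).exists_dist_lt z ht
  refine ⟨Metric.ball y t, Metric.isOpen_ball.mem_nhds hzy, ?_⟩
  have hfin : IsFiniteMeasure (volume.restrict (Metric.ball y t)) :=
    ⟨by simpa using measure_ball_lt_top⟩
  have hint : Integrable (fun x => w y - v x) (volume.restrict (Metric.ball y t)) := by
    refine ⟨(measurable_const.sub hv).aestronglyMeasurable, ?_⟩
    rw [hasFiniteIntegral_iff_norm]
    exact hy
  exact ((integrable_const (w y)).sub hint).congr (Eventually.of_forall fun x => by simp)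

theorem volume_ball_mul_lintegral_translate_sub_le (hv : Measurable v) (hw : Measurable w)
    {h : EuclideanSpace ℝ (Fin n)} (hh : ‖h‖ ≤ t) :
    volume (Metric.ball (0 : EuclideanSpace ℝ (Fin n)) (t / 2)) *
        ∫⁻ x, ENNReal.ofReal |v (x + h) - v x| ≤ 2 * ballOscillation t v w := by
  have hsub : ∀ x : EuclideanSpace ℝ (Fin n),
      Metric.ball (x + (2⁻¹ : ℝ) • h) (t / 2) ⊆ Metric.ball x t ∩ Metric.ball (x + h) t := by
    intro x
    have hn : ‖(2⁻¹ : ℝ) • h‖ ≤ t / 2 := by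
      rw [norm_smul, Real.norm_eq_abs, abs_of_pos (by norm_num)]; linarith
    refine Set.subset_inter (Metric.ball_subset_ball' ?_) (Metric.ball_subset_ball' ?_)
    · rw [dist_eq_norm, add_sub_cancel_left]; linarith
    · have : x + (2⁻¹ : ℝ) • h - (x + h) = -((2⁻¹ : ℝ) • h) := by module
      rw [dist_eq_norm, this, norm_neg]; linarith
  rw [← lintegral_const_mul' _ _ measure_ball_lt_top.ne]
  calc _ ≤ ∫⁻ x, ((∫⁻ y in Metric.ball (x + h) t, ENNReal.ofReal |v (x + h) - w y|) +
          ∫⁻ y in Metric.ball x t, ENNReal.ofReal |v x - w y|) := by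
        refine lintegral_mono fun x => ?_
        dsimp only
        rw [← Measure.addHaar_ball_center volume (x + (2⁻¹ : ℝ) • h), mul_comm,
          ← setLIntegral_const]
        calc _ ≤ ∫⁻ y in Metric.ball (x + (2⁻¹ : ℝ) • h) (t / 2),
              (ENNReal.ofReal |v (x + h) - w y| + ENNReal.ofReal |v x - w y|) := by
              refine lintegral_mono fun y => ?_
              dsimp only
              rw [← ENNReal.ofReal_add (abs_nonneg _) (abs_nonneg _)]
              refine ENNReal.ofReal_le_ofReal ?_
              rw [abs_sub_comm (v x)]
              exact abs_sub_le _ _ _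
          _ = _ := lintegral_add_left (by fun_prop) _
          _ ≤ _ := by
              gcongr
              · exact (hsub x).trans Set.inter_subset_right
              · exact (hsub x).trans Set.inter_subset_left
    _ = ballOscillation t v w + ballOscillation t v w := by
        rw [lintegral_add_right _ (measurable_lintegral_ball hv hw t)]
        congr 1
        exact lintegral_add_right_eq_self
          (fun x => ∫⁻ y in Metric.ball x t, ENNReal.ofReal |v x - w y|) h
    _ = _ := (two_mul _).symm

theorem lintegral_translate_sub_le (hv : Measurable v) (hw : Measurable w) (ht : 0 < t)
    {h : EuclideanSpace ℝ (Fin n)} (hh : ‖h‖ ≤ t) :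
    ∫⁻ x, ENNReal.ofReal |v (x + h) - v x| ≤
      2 ^ (n + 1) / volume (Metric.ball (0 : EuclideanSpace ℝ (Fin n)) 1) *
        (ballOscillation t v w / ENNReal.ofReal (t ^ n)) := by
  have key := volume_ball_mul_lintegral_translate_sub_le hv hw hh
  set ω := volume (Metric.ball (0 : EuclideanSpace ℝ (Fin n)) 1) with hω
  have hω0 : ω ≠ 0 := (Metric.measure_ball_pos _ _ one_pos).ne'
  have hωt : ω ≠ ∞ := measure_ball_lt_top.ne
  rw [Measure.addHaar_ball_of_pos _ _ (half_pos ht), finrank_euclideanSpace_fin, ← hω, div_pow,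
    ENNReal.ofReal_div_of_pos (by positivity), ENNReal.ofReal_pow zero_le_two,
    ENNReal.ofReal_ofNat] at key
  have hT0 : ENNReal.ofReal (t ^ n) ≠ 0 := by simpa using pow_pos ht n
  have hTt : ENNReal.ofReal (t ^ n) ≠ ∞ := ENNReal.ofReal_ne_top
  set T := ENNReal.ofReal (t ^ n)
  have h20 : (2 : ℝ≥0∞) ^ n ≠ 0 := by simp
  have h2t : (2 : ℝ≥0∞) ^ n ≠ ∞ := by finiteness
  have hc0 : T / 2 ^ n * ω ≠ 0 := mul_ne_zero (ENNReal.div_ne_zero.2 ⟨hT0, h2t⟩) hω0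
  have hct : T / 2 ^ n * ω ≠ ∞ := ENNReal.mul_ne_top (ENNReal.div_ne_top hTt h20) hωt
  rw [mul_comm, ← ENNReal.le_div_iff_mul_le (Or.inl hc0) (Or.inl hct)] at key
  refine key.trans_eq ?_
  rw [div_eq_mul_inv, ENNReal.mul_inv (Or.inr hωt) (Or.inr hω0),
    ENNReal.inv_div (Or.inl h2t) (Or.inl h20), pow_succ]
  simp only [div_eq_mul_inv]
  ring

end Oscillation

section TotalVariation

variable {n : ℕ} {v : EuclideanSpace ℝ (Fin n) → ℝ}

theorem tendsto_integral_inv_smul_sub_mul {C : ℝ≥0} {f : EuclideanSpace ℝ (Fin n) → ℝ}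
    (hf : LipschitzWith C f) (h'f : HasCompactSupport f) (hv : LocallyIntegrable v volume)
    (e : EuclideanSpace ℝ (Fin n)) :
    Tendsto (fun t : ℝ => ∫ x, (t⁻¹ • (f (x + t • e) - f x)) * v x) (𝓝[>] 0)
      (𝓝 (∫ x, lineDeriv ℝ f x e * v x)) := by
  let K := Metric.cthickening ‖e‖ (tsupport f)
  have hK : IsCompact K := IsCompact.cthickening h'f
  have h0 : ∀ x ∉ K, ∀ t ∈ Set.Ioc (0 : ℝ) 1, f x = 0 ∧ f (x + t • e) = 0 := by
    intro x hx t ht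
    constructor
    · rw [← Function.notMem_support]
      contrapose hx
      exact Metric.self_subset_cthickening _ (subset_tsupport _ hx)
    · rw [← Function.notMem_support]
      contrapose hx
      apply Metric.mem_cthickening_of_dist_le _ _ (‖e‖) (tsupport f) (subset_tsupport _ hx)
      simp only [dist_eq_norm, sub_add_cancel_left, norm_neg, norm_smul, Real.norm_eq_abs,
        abs_of_nonneg ht.1.le]
      exact mul_le_of_le_one_left (norm_nonneg e) ht.2
  have hg : Integrable (K.indicator v) volume :=
    (integrable_indicator_iff hK.measurableSet).2 (hv.integrableOn_isCompact hK)
  have hlim := hf.integral_inv_smul_sub_mul_tendsto_integral_lineDeriv_mul hg e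
  have hd : ∀ x ∉ K, lineDeriv ℝ f x e = 0 := by
    intro x hx
    have hU : ∀ᶠ s : ℝ in 𝓝 0, x + s • e ∉ tsupport f := by
      have hx' : x ∉ tsupport f := fun h => hx (Metric.self_subset_cthickening _ h)
      have hc : ContinuousAt (fun s : ℝ => x + s • e) 0 := by fun_prop
      exact hc.eventually_mem ((isClosed_tsupport f).isOpen_compl.mem_nhds (by simpa using hx'))
    have : (fun s : ℝ => f (x + s • e)) =ᶠ[𝓝 0] fun _ => 0 :=
      hU.mono fun s hs => image_eq_zero_of_notMem_tsupport hs
    rw [lineDeriv, this.deriv_eq, deriv_const]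
  have hright : ∫ x, lineDeriv ℝ f x e * K.indicator v x = ∫ x, lineDeriv ℝ f x e * v x := by
    refine integral_congr_ae (Eventually.of_forall fun x => ?_)
    by_cases hx : x ∈ K
    · simp [hx]
    · simp [hx, hd x hx]
  rw [hright] at hlim
  refine hlim.congr' ?_
  filter_upwards [Ioc_mem_nhdsGT zero_lt_one] with t ht
  refine integral_congr_ae (Eventually.of_forall fun x => ?_)
  by_cases hx : x ∈ K
  · simp [hx]
  · simp [hx, h0 x hx t ht]

theorem integral_translate_sub_mul_le {f : EuclideanSpace ℝ (Fin n) → ℝ} (hf : Continuous f)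
    (h'f : HasCompactSupport f) (hf1 : ∀ x, |f x| ≤ 1) (hv : LocallyIntegrable v volume)
    (h : EuclideanSpace ℝ (Fin n)) {M : ℝ} (hM : 0 ≤ M)
    (hle : ∫⁻ x, ENNReal.ofReal |v (x + h) - v x| ≤ ENNReal.ofReal M) :
    -∫ x, (f (x - h) - f x) * v x ≤ M := by
  have hi1 : Integrable (fun x => f x * v x) :=
    hv.integrable_smul_left_of_hasCompactSupport hf h'f
  have hi2 : Integrable (fun x => f (x - h) * v x) := by
    refine hv.integrable_smul_left_of_hasCompactSupport (g := fun x => f (x - h))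
      (by fun_prop) ?_
    simp_rw [sub_eq_add_neg]
    exact h'f.comp_homeomorph (Homeomorph.addRight (-h))
  have hi3 : Integrable (fun x => f x * v (x + h)) := by
    simpa using hi2.comp_add_right h
  have hshift : ∫ x, f (x - h) * v x = ∫ x, f x * v (x + h) := by
    rw [← integral_add_right_eq_self _ h]; simp
  have heq : -∫ x, (f (x - h) - f x) * v x = ∫ x, -(f x * (v (x + h) - v x)) := by
    simp_rw [sub_mul, mul_sub]
    rw [integral_neg, integral_sub hi2 hi1, integral_sub hi3 hi1, hshift]
  rw [heq]
  refine (le_abs_self _).trans ?_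
  rw [← Real.norm_eq_abs, ← ENNReal.ofReal_le_ofReal_iff hM, ofReal_norm]
  refine (enorm_integral_le_lintegral_enorm _).trans (le_trans (lintegral_mono fun x => ?_) hle)
  dsimp only
  rw [← ofReal_norm]
  refine ENNReal.ofReal_le_ofReal ?_
  rw [norm_neg, norm_mul, Real.norm_eq_abs, Real.norm_eq_abs]
  exact mul_le_of_le_one_left (abs_nonneg _) (hf1 x)

theorem divergence_eq_sum_neg_lineDeriv
    {φ : EuclideanSpace ℝ (Fin n) → EuclideanSpace ℝ (Fin n)} (hφ : Differentiable ℝ φ)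
    (x : EuclideanSpace ℝ (Fin n)) :
    divergence φ x =
      ∑ i, -lineDeriv ℝ (fun y => φ y i) x (-EuclideanSpace.single i 1) := by
  refine Finset.sum_congr rfl fun i _ => ?_
  have h : HasFDerivAt (fun y => φ y i)
      ((EuclideanSpace.proj i : EuclideanSpace ℝ (Fin n) →L[ℝ] ℝ).comp (fderiv ℝ φ x)) x :=
    (EuclideanSpace.proj i : EuclideanSpace ℝ (Fin n) →L[ℝ] ℝ).hasFDerivAt.comp x
      (hφ x).hasFDerivAt
  rw [(h.hasLineDerivAt _).lineDeriv]
  simp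

theorem totalVariation_le_of_frequently (hv : LocallyIntegrable v volume) {M : ℝ} (hM : 0 ≤ M)
    (h : ∃ᶠ t : ℝ in 𝓝[>] 0, ∀ e : EuclideanSpace ℝ (Fin n), ‖e‖ ≤ 1 →
      ∫⁻ x, ENNReal.ofReal |v (x + t • e) - v x| ≤ ENNReal.ofReal (M * t)) :
    totalVariation v ≤ ENNReal.ofReal (n * M) := by
  refine iSup_le fun φ => iSup_le fun hφ => iSup_le fun hsupp => iSup_le fun hle => ?_
  refine ENNReal.ofReal_le_ofReal ?_
  have hcoord : ∀ i, ContDiff ℝ 1 fun y => φ y i := fun i => contDiff_euclidean.1 hφ i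
  have hcs : ∀ i, HasCompactSupport fun y => φ y i := fun i =>
    hsupp.comp_left (g := fun z : EuclideanSpace ℝ (Fin n) => z i) rfl
  have hlip : ∀ i, ∃ C, LipschitzWith C fun y => φ y i := fun i =>
    (hcoord i).lipschitzWith_of_hasCompactSupport (hcs i) one_ne_zero
  choose C hC using hlip
  have hlim := tendsto_finsetSum Finset.univ fun i _ =>
    (tendsto_integral_inv_smul_sub_mul (hC i) (hcs i) hv (-EuclideanSpace.single i 1)).neg
  have hdiv : ∑ i, -∫ x, lineDeriv ℝ (fun y => φ y i) x (-EuclideanSpace.single i 1) * v x =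
      ∫ x, v x * divergence φ x := by
    simp_rw [divergence_eq_sum_neg_lineDeriv (hφ.differentiable one_ne_zero), Finset.mul_sum]
    rw [integral_finsetSum]
    · refine Finset.sum_congr rfl fun i _ => ?_
      rw [← integral_neg]
      congr with x
      ring
    · intro i _
      have hd : ∀ x, -lineDeriv ℝ (fun y => φ y i) x (-EuclideanSpace.single i 1) =
          fderiv ℝ (fun y => φ y i) x (EuclideanSpace.single i 1) := fun x => by
        rw [((hcoord i).differentiable one_ne_zero x).lineDeriv_eq_fderiv]; simp
      simp_rw [hd]
      refine hv.integrable_smul_right_of_hasCompactSupport ?_ ?_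
      · exact ((hcoord i).continuous_fderiv one_ne_zero).clm_apply continuous_const
      · exact (hcs i).fderiv_apply ℝ _
  rw [hdiv] at hlim
  refine le_of_tendsto_of_frequently hlim ?_
  refine (h.and_eventually self_mem_nhdsWithin).mono fun t ⟨ht, (ht0 : 0 < t)⟩ => ?_
  calc _ ≤ ∑ _i : Fin n, M := Finset.sum_le_sum fun i _ => ?_
    _ = n * M := by simp
  have hf1 : ∀ x, |φ x i| ≤ 1 := fun x =>
    (Real.norm_eq_abs _ ▸ PiLp.norm_apply_le (φ x) i).trans (hle x)
  have := integral_translate_sub_mul_le (hcoord i).continuous (hcs i) hf1 hv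
    (t • EuclideanSpace.single i 1) (by positivity) (ht _ (by simp))
  have hrw : ∀ x, t⁻¹ • (φ (x + t • -EuclideanSpace.single i 1) i - φ x i) * v x =
      t⁻¹ * ((φ (x - t • EuclideanSpace.single i 1) i - φ x i) * v x) := fun x => by
    rw [smul_neg, ← sub_eq_add_neg, smul_eq_mul, mul_assoc]
  simp_rw [hrw]
  rw [integral_const_mul, ← mul_neg, inv_mul_le_iff₀ ht0, mul_comm t]
  exact this

end TotalVariation

section Slicing

variable {n : ℕ}

/-- The point of `ℝ^(n+1)` with horizontal part `z` and last coordinate `t`. -/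
def heightPoint (t : ℝ) (z : EuclideanSpace ℝ (Fin n)) : EuclideanSpace ℝ (Fin (n + 1)) :=
  WithLp.toLp 2 (Fin.snoc (α := fun _ => ℝ) (fun i => z i) t)

theorem measurePreserving_heightPoint :
    MeasurePreserving (fun p : ℝ × EuclideanSpace ℝ (Fin n) => heightPoint p.1 p.2) := by
  have h1 : MeasurePreserving (Prod.map id (@WithLp.ofLp 2 (Fin n → ℝ)))
      (volume.prod volume) (volume.prod volume) :=
    (MeasurePreserving.id (volume : Measure ℝ)).prod (PiLp.volume_preserving_ofLp (Fin n))
  have h2 := (volume_preserving_piFinSuccAbove (fun _ : Fin (n + 1) => ℝ) (Fin.last n)).symm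
  have h3 := PiLp.volume_preserving_toLp (Fin (n + 1))
  convert h3.comp (h2.comp h1) using 1
  funext p
  simp [heightPoint, MeasurableEquiv.piFinSuccAbove, Fin.insertNthEquiv]
  rfl

theorem measurable_heightPoint :
    Measurable fun p : ℝ × EuclideanSpace ℝ (Fin n) => heightPoint p.1 p.2 :=
  measurePreserving_heightPoint.measurable

theorem measurableSet_halfSpace : MeasurableSet (halfSpace n) :=
  measurableSet_lt measurable_const (by fun_prop)

theorem lintegral_halfSpace {f : EuclideanSpace ℝ (Fin (n + 1)) → ℝ≥0∞} (hf : Measurable f) :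
    ∫⁻ y in halfSpace n, f y = ∫⁻ t in Set.Ioi (0 : ℝ), ∫⁻ z, f (heightPoint t z) := by
  rw [← measurePreserving_heightPoint.setLIntegral_comp_preimage measurableSet_halfSpace hf]
  have hpre : (fun p : ℝ × EuclideanSpace ℝ (Fin n) => heightPoint p.1 p.2) ⁻¹' halfSpace n =
      Set.Ioi 0 ×ˢ Set.univ := by
    ext p
    simp [halfSpace, heightPoint]
  rw [hpre, Measure.volume_eq_prod, setLIntegral_prod]
  · simp
  · exact (hf.comp measurable_heightPoint).aemeasurable

theorem norm_boundaryPoint_sub_heightPoint_le (x z : EuclideanSpace ℝ (Fin n)) {t : ℝ}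
    (ht : 0 ≤ t) : ‖boundaryPoint x - heightPoint t z‖ ≤ dist z x + t := by
  rw [dist_comm, dist_eq_norm, EuclideanSpace.norm_eq, EuclideanSpace.norm_eq]
  refine Real.sqrt_le_iff.2 ⟨by positivity, ?_⟩
  rw [Fin.sum_univ_castSucc]
  have hs : 0 ≤ ∑ i, ‖(x - z) i‖ ^ 2 := by positivity
  have hcast : ∑ i : Fin n, ‖(boundaryPoint x - heightPoint t z) i.castSucc‖ ^ 2 =
      ∑ i, ‖(x - z) i‖ ^ 2 := by simp [boundaryPoint, heightPoint]
  have hlast : ‖(boundaryPoint x - heightPoint t z) (Fin.last n)‖ ^ 2 = t ^ 2 := by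
    simp [boundaryPoint, heightPoint]
  rw [hcast, hlast, add_sq, Real.sq_sqrt hs]
  have := Real.sqrt_nonneg (∑ i, ‖(x - z) i‖ ^ 2)
  nlinarith [mul_nonneg this ht]

theorem norm_boundaryPoint_sub_heightPoint_pos (x z : EuclideanSpace ℝ (Fin n)) {t : ℝ}
    (ht : 0 < t) : 0 < ‖boundaryPoint x - heightPoint t z‖ := by
  rw [norm_pos_iff]
  intro h
  have := congrArg (fun y : EuclideanSpace ℝ (Fin (n + 1)) => y (Fin.last n)) h
  simp [boundaryPoint, heightPoint] at this
  exact ht.ne' this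

theorem continuous_boundaryPoint :
    Continuous (boundaryPoint : EuclideanSpace ℝ (Fin n) → _) := by
  refine (PiLp.continuous_toLp 2 _).comp ?_
  exact Continuous.finSnoc (by fun_prop) continuous_const

variable {u : EuclideanSpace ℝ (Fin (n + 1)) → ℝ} {v : EuclideanSpace ℝ (Fin n) → ℝ}

theorem measurable_conjunctionIntegrand (hu : Measurable u) (hv : Measurable v) (a : ℝ) :
    Measurable fun p : EuclideanSpace ℝ (Fin n) × EuclideanSpace ℝ (Fin (n + 1)) =>
      ENNReal.ofReal (|v p.1 - u p.2| / ‖boundaryPoint p.1 - p.2‖ ^ a) := by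
  have hb : Measurable (boundaryPoint : EuclideanSpace ℝ (Fin n) → _) :=
    continuous_boundaryPoint.measurable
  have h1 : Measurable fun p : EuclideanSpace ℝ (Fin n) × EuclideanSpace ℝ (Fin (n + 1)) =>
      |v p.1 - u p.2| := continuous_abs.measurable.comp
    ((hv.comp measurable_fst).sub (hu.comp measurable_snd))
  have h2 : Measurable fun p : EuclideanSpace ℝ (Fin n) × EuclideanSpace ℝ (Fin (n + 1)) =>
      ‖boundaryPoint p.1 - p.2‖ ^ a :=
    ((hb.comp measurable_fst).sub measurable_snd).norm.pow_const a
  exact (h1.div h2).ennreal_ofReal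

theorem conjunctionIntegral_eq_lintegral_height (hu : Measurable u) (hv : Measurable v) (s : ℝ) :
    conjunctionIntegral s u v = ∫⁻ t in Set.Ioi (0 : ℝ), ∫⁻ x, ∫⁻ z,
      ENNReal.ofReal (|v x - u (heightPoint t z)| /
        ‖boundaryPoint x - heightPoint t z‖ ^ (((n + 1 : ℕ) : ℝ) + s)) := by
  have hm := measurable_conjunctionIntegrand hu hv (((n + 1 : ℕ) : ℝ) + s)
  refine (lintegral_congr fun x =>
    lintegral_halfSpace (hm.comp (measurable_prodMk_left (x := x)))).trans
    (lintegral_lintegral_swap ?_)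
  have h : Measurable fun q : (EuclideanSpace ℝ (Fin n) × ℝ) × EuclideanSpace ℝ (Fin n) =>
      (q.1.1, heightPoint q.1.2 q.2) :=
    (measurable_fst.comp measurable_fst).prodMk
      (measurable_heightPoint.comp ((measurable_snd.comp measurable_fst).prodMk measurable_snd))
  exact ((hm.comp h).lintegral_prod_right' (ν := volume)).aemeasurable

theorem rpow_mul_ballOscillation_le {s t : ℝ} (hs0 : 0 ≤ s) (hs1 : s ≤ 1) (ht : 0 < t) :
    ENNReal.ofReal ((2 ^ (n + 2) * t ^ (((n + 1 : ℕ) : ℝ) + s))⁻¹) *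
        ballOscillation t v (fun z => u (heightPoint t z)) ≤
      ∫⁻ x, ∫⁻ z, ENNReal.ofReal (|v x - u (heightPoint t z)| /
        ‖boundaryPoint x - heightPoint t z‖ ^ (((n + 1 : ℕ) : ℝ) + s)) := by
  unfold ballOscillation
  rw [← lintegral_const_mul' _ _ ENNReal.ofReal_ne_top]
  refine lintegral_mono fun x => ?_
  dsimp only
  rw [← lintegral_const_mul' _ _ ENNReal.ofReal_ne_top]
  refine le_trans ?_ (setLIntegral_le_lintegral (Metric.ball x t) _)
  refine setLIntegral_mono' Metric.isOpen_ball.measurableSet fun z hz => ?_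
  rw [← ENNReal.ofReal_mul (by positivity), mul_comm, ← div_eq_mul_inv]
  refine ENNReal.ofReal_le_ofReal ?_
  have hpos := norm_boundaryPoint_sub_heightPoint_pos x z ht
  have hle : ‖boundaryPoint x - heightPoint t z‖ ≤ 2 * t := by
    have := norm_boundaryPoint_sub_heightPoint_le x z ht.le
    have hz' : dist z x < t := hz
    linarith
  refine div_le_div_of_nonneg_left (abs_nonneg _) (by positivity) ?_
  calc _ ≤ (2 * t) ^ (((n + 1 : ℕ) : ℝ) + s) :=
        Real.rpow_le_rpow hpos.le hle (by positivity)
    _ = 2 ^ (((n + 1 : ℕ) : ℝ) + s) * t ^ (((n + 1 : ℕ) : ℝ) + s) :=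
        Real.mul_rpow zero_le_two ht.le
    _ ≤ _ := by
        gcongr
        rw [← Real.rpow_natCast]
        refine Real.rpow_le_rpow_of_exponent_le one_le_two ?_
        push_cast
        linarith

theorem lintegral_Ioo_rpow_neg {s δ : ℝ} (hs : s < 1) (hδ : 0 < δ) :
    ∫⁻ t in Set.Ioo 0 δ, ENNReal.ofReal (t ^ (-s)) =
      ENNReal.ofReal (δ ^ (1 - s) / (1 - s)) := by
  have hi : IntegrableOn (fun t : ℝ => t ^ (-s)) (Set.Ioo 0 δ) :=
    (intervalIntegral.integrableOn_Ioo_rpow_iff hδ).2 (by linarith)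
  rw [← ofReal_integral_eq_lintegral_ofReal hi]
  · rw [← integral_Ioc_eq_integral_Ioo, ← intervalIntegral.integral_of_le hδ.le,
      integral_rpow (Or.inl (by linarith)), Real.zero_rpow (by linarith), neg_add_eq_sub, sub_zero]
  · filter_upwards [ae_restrict_mem measurableSet_Ioo] with t ht
    exact Real.rpow_nonneg ht.1.le _

theorem frequently_ballOscillation_lt (hu : Measurable u) (hv : Measurable v) {K : ℝ≥0}
    (hK : liminf (fun s : ℝ => ENNReal.ofReal (1 - s) * conjunctionIntegral s u v)
      (𝓝[<] (1 : ℝ)) < K) :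
    ∃ᶠ t : ℝ in 𝓝[>] 0, ballOscillation t v (fun z => u (heightPoint t z)) <
      ENNReal.ofReal (2 ^ (n + 2) * K * t ^ (n + 1)) := by
  intro hcon
  simp only [not_lt] at hcon
  obtain ⟨δ, hδ, hδt⟩ := mem_nhdsGT_iff_exists_Ioo_subset.1 hcon
  have hδ0 : (0 : ℝ) < δ := hδ
  have hbound : ∀ s ∈ Set.Ioo (0 : ℝ) 1, ENNReal.ofReal (K * δ ^ (1 - s)) ≤
      ENNReal.ofReal (1 - s) * conjunctionIntegral s u v := by
    intro s hs
    have h1s : 0 < 1 - s := by linarith [hs.2]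
    have hint : ENNReal.ofReal (K * (δ ^ (1 - s) / (1 - s))) ≤ conjunctionIntegral s u v := by
      rw [conjunctionIntegral_eq_lintegral_height hu hv, ENNReal.ofReal_mul K.coe_nonneg,
        ← lintegral_Ioo_rpow_neg hs.2 hδ0, ← lintegral_const_mul' _ _ ENNReal.ofReal_ne_top]
      refine le_trans ?_ (lintegral_mono_set
        (Set.Ioo_subset_Ioi_self : Set.Ioo 0 δ ⊆ Set.Ioi 0))
      refine setLIntegral_mono' measurableSet_Ioo fun t ht => ?_
      refine le_trans ?_ (rpow_mul_ballOscillation_le hs.1.le hs.2.le ht.1)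
      refine le_trans ?_ (mul_le_mul_right (hδt ht) _)
      have ht0 : 0 < t := ht.1
      rw [← ENNReal.ofReal_mul K.coe_nonneg, ← ENNReal.ofReal_mul (by positivity)]
      refine ENNReal.ofReal_le_ofReal (le_of_eq ?_)
      rw [Real.rpow_add ht0, Real.rpow_natCast, Real.rpow_neg ht0.le]
      have := Real.rpow_pos_of_pos ht0 s
      field_simp
    refine le_trans (le_of_eq ?_) (mul_le_mul_right hint _)
    rw [← ENNReal.ofReal_mul h1s.le]
    congr 1
    field_simp
  have hlim : Tendsto (fun s : ℝ => ENNReal.ofReal (K * δ ^ (1 - s))) (𝓝[<] 1) (𝓝 K) := by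
    have hc : ContinuousAt (fun s : ℝ => ENNReal.ofReal (K * δ ^ (1 - s))) 1 := by
      refine ENNReal.continuous_ofReal.continuousAt.comp ?_
      exact continuousAt_const.mul
        ((Real.continuous_const_rpow hδ0.ne').comp (by fun_prop)).continuousAt
    have := hc.tendsto.mono_left (nhdsWithin_le_nhds (s := Set.Iio 1))
    simpa using this
  refine hK.not_ge ?_
  rw [← hlim.liminf_eq]
  refine liminf_le_liminf ?_
  filter_upwards [Ioo_mem_nhdsLT zero_lt_one] with s hs
  exact hbound s hs

theorem conjunctionIntegral_congr {u' : EuclideanSpace ℝ (Fin (n + 1)) → ℝ}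
    {v' : EuclideanSpace ℝ (Fin n) → ℝ} (hu : u =ᵐ[volume.restrict (halfSpace n)] u')
    (hv : v =ᵐ[volume] v') (s : ℝ) : conjunctionIntegral s u v = conjunctionIntegral s u' v' := by
  refine lintegral_congr_ae ?_
  filter_upwards [hv] with x hx
  refine lintegral_congr_ae ?_
  filter_upwards [hu] with y hy
  rw [hx, hy]

theorem totalVariation_congr {v' : EuclideanSpace ℝ (Fin n) → ℝ} (hv : v =ᵐ[volume] v') :
    totalVariation v = totalVariation v' := by
  have h : ∀ φ, ∫ x, v x * divergence φ x = ∫ x, v' x * divergence φ x := fun φ =>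
    integral_congr_ae (hv.mono fun x hx => by simp only [hx])
  simp_rw [totalVariation, h]

/-- The factor in the comparison of the total variation with the trace conjunction integral. -/
noncomputable def traceConstant (n : ℕ) : ℝ≥0 :=
  n * (2 ^ (n + 1) / (volume (Metric.ball (0 : EuclideanSpace ℝ (Fin n)) 1)).toNNReal) *
    2 ^ (n + 2)

theorem locallyIntegrable_and_totalVariation_le (hu : Measurable u) (hv : Measurable v) {K : ℝ≥0}
    (hK : liminf (fun s : ℝ => ENNReal.ofReal (1 - s) * conjunctionIntegral s u v)
      (𝓝[<] (1 : ℝ)) < K) :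
    LocallyIntegrable v volume ∧ totalVariation v ≤ (traceConstant n * K : ℝ≥0) := by
  have hfreq := (frequently_ballOscillation_lt hu hv hK).and_eventually self_mem_nhdsWithin
  have hw : ∀ t : ℝ, Measurable fun z : EuclideanSpace ℝ (Fin n) => u (heightPoint t z) :=
    fun t => hu.comp (measurable_heightPoint.comp measurable_prodMk_left)
  have hloc : LocallyIntegrable v volume := by
    obtain ⟨t, ht, (ht0 : 0 < t)⟩ := hfreq.exists
    exact locallyIntegrable_of_ballOscillation_lt_top hv (hw t) ht0
      (ht.trans ENNReal.ofReal_lt_top)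
  refine ⟨hloc, ?_⟩
  set ω := volume (Metric.ball (0 : EuclideanSpace ℝ (Fin n)) 1) with hω
  have hω0 : ω ≠ 0 := (Metric.measure_ball_pos _ _ one_pos).ne'
  have hωt : ω ≠ ∞ := (measure_ball_lt_top (μ := volume)).ne
  have hωr : 0 < ω.toReal := ENNReal.toReal_pos hω0 hωt
  have hM : 0 ≤ 2 ^ (n + 1) / ω.toReal * (2 ^ (n + 2) * (K : ℝ)) := by positivity
  refine (totalVariation_le_of_frequently hloc hM ?_).trans_eq ?_
  · refine hfreq.mono fun t ⟨ht, (ht0 : 0 < t)⟩ e he => ?_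
    have hte : ‖t • e‖ ≤ t := by
      rw [norm_smul, Real.norm_eq_abs, abs_of_pos ht0]
      exact mul_le_of_le_one_right ht0.le he
    refine (lintegral_translate_sub_le hv (hw t) ht0 hte).trans ?_
    rw [← hω]
    have h2 : (2 : ℝ≥0∞) ^ (n + 1) / ω = ENNReal.ofReal (2 ^ (n + 1) / ω.toReal) := by
      rw [ENNReal.ofReal_div_of_pos hωr, ENNReal.ofReal_toReal hωt,
        ENNReal.ofReal_pow zero_le_two, ENNReal.ofReal_ofNat]
    rw [h2, mul_assoc, ENNReal.ofReal_mul (by positivity)]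
    gcongr
    refine (ENNReal.div_le_div_right ht.le _).trans_eq ?_
    rw [← ENNReal.ofReal_div_of_pos (by positivity)]
    congr 1
    rw [pow_succ t]
    field_simp
  · rw [← ENNReal.ofReal_coe_nnreal]
    congr 1
    simp only [traceConstant, NNReal.coe_mul, NNReal.coe_div, NNReal.coe_natCast, NNReal.coe_pow,
      NNReal.coe_ofNat, ENNReal.coe_toNNReal_eq_toReal]
    ring

end Slicing

end TraceConjunction

/-- Here `N = n + 1` with `N ≥ 2`, and the constant `C` depends on `N` only. -/
theorem theorem8p4 (n : ℕ) (hn : 1 ≤ n) :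
    ∃ C : ℝ≥0, ∀ (u : EuclideanSpace ℝ (Fin (n + 1)) → ℝ) (v : EuclideanSpace ℝ (Fin n) → ℝ),
      AEMeasurable u (volume.restrict (TraceConjunction.halfSpace n)) →
      AEMeasurable v volume →
      liminf (fun s : ℝ => ENNReal.ofReal (1 - s) * TraceConjunction.conjunctionIntegral s u v)
        (𝓝[<] (1 : ℝ)) < ∞ →
      TraceConjunction.IsBV v ∧
        TraceConjunction.totalVariation v ≤
          (C : ℝ≥0∞) * liminf (fun s : ℝ =>
            ENNReal.ofReal (1 - s) * TraceConjunction.conjunctionIntegral s u v)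
            (𝓝[<] (1 : ℝ)) := by
  open TraceConjunction in
  refine ⟨traceConstant n, fun u v hu hv hL => ?_⟩
  simp_rw [conjunctionIntegral_congr hu.ae_eq_mk hv.ae_eq_mk] at hL ⊢
  set L := liminf (fun s : ℝ => ENNReal.ofReal (1 - s) *
    conjunctionIntegral s (hu.mk u) (hv.mk v)) (𝓝[<] (1 : ℝ)) with hLdef
  have key : ∀ K : ℝ≥0, L < K → LocallyIntegrable v volume ∧
      totalVariation v ≤ traceConstant n * (K : ℝ≥0∞) := fun K hK => by
    obtain ⟨h1, h2⟩ :=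
      locallyIntegrable_and_totalVariation_le hu.measurable_mk hv.measurable_mk hK
    exact ⟨h1.congr hv.ae_eq_mk.symm, by
      rwa [totalVariation_congr hv.ae_eq_mk, ← ENNReal.coe_mul]⟩
  have hle : totalVariation v ≤ traceConstant n * L := by
    have hcont : Tendsto (fun K : ℝ≥0∞ => traceConstant n * K) (𝓝[>] L)
        (𝓝 (traceConstant n * L)) :=
      ((ENNReal.continuous_const_mul ENNReal.coe_ne_top).tendsto L).mono_left nhdsWithin_le_nhds
    have : (𝓝[>] L).NeBot := nhdsGT_neBot_of_exists_gt ⟨∞, hL⟩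
    refine ge_of_tendsto hcont ?_
    filter_upwards [Ioo_mem_nhdsGT hL] with K hK
    lift K to ℝ≥0 using hK.2.ne
    exact (key K hK.1).2
  obtain ⟨K, hK, -⟩ := ENNReal.lt_iff_exists_nnreal_btwn.1 hL
  exact ⟨⟨(key K hK).1, hle.trans_lt (ENNReal.mul_lt_top ENNReal.coe_lt_top hL)⟩, hle⟩
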